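/- **Theorem (parallel distributed Grover search).** Let $n>k\ge 1$, $f:\{0,1\}^n\to\{0,1\}$ and $a=|\{x: f(x)=1\}|\ge 1$. For $i\in\{0,\dots,2^k-1\}$ let $y_i\in\{0,1\}^k$ be the binary representation of $i$, let $f_i(x)=f(xy_i)$ for $x\in\{0,1\}^{n-k}$, and let $a_i=|\{x: f_i(x)=1\}|$. Put $N=2^{n-k}$, $M=\lceil\sqrt N\,\rceil$ and $t_a=\lceil 2\pi\sqrt a+11\rceil$. Let $Z_{f_i}|x\rangle=(-1)^{f_i(x)}|x\rangle$, let $Z_0$ change the sign of $|0^{n-k}\rangle$ and fix the other basis states, and let $G_i=-H^{\otimes (n-k)}Z_0H^{\otimes (n-k)}Z_{f_i}$. *Grover's algorithm for $f_i$ with presumed number of solutions $b$* applies $G_i$ exactly $\lfloor\frac{\pi}{4}\sqrt{N/b}\rfloor$ times to $H^{\otimes (n-k)}|0^{n-k}\rangle$ and measures. *Quantum counting for $f_i$* prepares $\frac1{\sqrt M}\sum_{j<M}|j\rangle\otimes H^{\otimes(n-k)}|0^{n-k}\rangle$, applies $|j\rangle|\psi\rangle\mapsto|j\rangle G_i^{\,j}|\psi\rangle$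 and then the inverse quantum Fourier transform of order $M$ to the first register, measures $y\in\{0,\dots,M-1\}$ there, and outputs the integer $a_i'$ nearest to $N\sin^2(\pi y/M)$; it uses at most $M$ queries to $f_i$. In the algorithm, $2^k$ machines $M_0,\dots,M_{2^k-1}$ work independently in parallel. $M_i$ runs quantum counting for $f_i$, which gives the range $R_i=\{b: 1\le b\le a,\ |b-a_i'|\le t_a\}=\{b_1,\dots,b_{r_i}\}$ (listed in an arbitrary order) of possible values of $a_i$. If $a_i=0$, $M_i$ stops. Otherwise, for $j=1,\dots,r_i$ in turn, it runs Grover's algorithm for $f_i$ with presumed number of solutions $b_j$ and checks with one query whether the measured $x$ satisfies $f_i(x)=1$; if so, it returns $xy_i$ and ends. Then for every $i$ with $a_i\ge 1$ the following hold. 1. Grover's algorithm for $f_i$ with presumed number of solutions $a_i$ measures a solution of $f_i$ with probability exactly $$P_{G_i}=\sin^2\!\left(\left(2\left\lfloor \frac{\pi\sqrt{N}}{4\sqrt{a_i}}\right\rfloor+1\right)\arcsin\frac{\sqrt{a_i}}{\sqrt{N}}\right).$$ 2. With probability one, $r_i\le 2t_a+1$, all $b_j$ satisfy $1\le b_j\le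 a$, $M_i$ makes at most $$\sum_{j=1}^{r_i}\left\lfloor\frac{\pi}{4}\sqrt{\frac{N}{b_j}}\right\rfloor+\lceil\sqrt N\,\rceil+2t_a+1$$ queries, and any string $z$ that it returns satisfies $f(z)=1$. 3. With probability at least $\frac{8}{\pi^2}P_{G_i}$, $M_i$ returns a string $z\in\{0,1\}^n$ with $f(z)=1$ within that number of queries. -/

import Mathlib

open scoped Kronecker ENNReal
open MeasureTheory

namespace DistGrover

/-! ### Unitary matrices, basis states and measurement -/

/-- Bit strings of length `m`; position `0` is the leftmost bit. -/
abbrev BitString (m : ℕ) : Type := Fin m → Bool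

/-- The all-zero string `0^m`. -/
def zeroString (m : ℕ) : BitString m := fun _ => false

section Unitaries

variable {ι κ : Type} [Fintype ι] [DecidableEq ι] [Fintype κ] [DecidableEq κ]

/-- The phase gate `|x⟩ ↦ -|x⟩` if `c x` holds and `|x⟩ ↦ |x⟩` otherwise. -/
noncomputable def signGate (c : ι → Bool) : Matrix.unitaryGroup ι ℂ :=
  ⟨Matrix.diagonal fun x => if c x then -1 else 1, by
    rw [Matrix.mem_unitaryGroup_iff, Matrix.star_eq_conjTranspose, Matrix.diagonal_conjTranspose,
      Matrix.diagonal_mul_diagonal, ← Matrix.diagonal_one]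
    congr 1
    funext x
    by_cases h : c x <;> simp [h]⟩

/-- `U ⊗ V`. -/
noncomputable def tensor (U : Matrix.unitaryGroup ι ℂ) (V : Matrix.unitaryGroup κ ℂ) :
    Matrix.unitaryGroup (ι × κ) ℂ :=
  ⟨U.1 ⊗ₖ V.1, Matrix.kronecker_mem_unitary U.2 V.2⟩

/-- The controlled gate `|w⟩|ψ⟩ ↦ |w⟩ V|ψ⟩` if `c w` holds and `|w⟩|ψ⟩ ↦ |w⟩|ψ⟩` otherwise. -/
noncomputable def controlled (c : ι → Bool) (V : Matrix.unitaryGroup κ ℂ) :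
    Matrix.unitaryGroup (ι × κ) ℂ :=
  ⟨Matrix.of fun p q => if p.1 = q.1 then (if c p.1 then V.1 else 1) p.2 q.2 else 0, by
    rw [Matrix.mem_unitaryGroup_iff]
    ext ⟨w, x⟩ ⟨w', x'⟩
    have hV : ∀ w : ι, (if c w then V.1 else 1) * star (if c w then V.1 else 1) = 1 := by
      intro w
      by_cases h : c w
      · simp only [h, if_true]
        exact Matrix.mem_unitaryGroup_iff.mp V.2
      · simp [h]
    by_cases h : w = w'
    · subst h
      have := congrFun (congrFun (hV w) x) x'
      simp only [Matrix.mul_apply, Matrix.star_apply] at this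
      simp [Matrix.mul_apply, Fintype.sum_prod_type, Matrix.one_apply] at this ⊢
      exact this
    · simp [Matrix.mul_apply, Fintype.sum_prod_type, h, Ne.symm h]⟩

/-- The outcome of measuring `U|s⟩` in the computational basis: `p` has probability
`|⟨p|U|s⟩|²`. -/
noncomputable def measure (U : Matrix.unitaryGroup ι ℂ) (s : ι) : PMF ι :=
  PMF.ofFintype (fun p => ENNReal.ofReal (‖U.1 p s‖ ^ 2)) (by
    rw [← ENNReal.ofReal_sum_of_nonneg fun _ _ => by positivity, ← ENNReal.ofReal_one]
    congr 1
    have h := congrFun (congrFun (Matrix.mem_unitaryGroup_iff'.mp U.2) s) s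
    simp only [Matrix.mul_apply, Matrix.star_apply, Matrix.one_apply_eq, RCLike.star_def,
      Complex.conj_mul'] at h
    exact_mod_cast h)

end Unitaries

/-- `H^{⊗m}`, with matrix entries `(-1)^{x·y} / √(2^m)`. -/
noncomputable def hadamard (m : ℕ) : Matrix.unitaryGroup (BitString m) ℂ :=
  ⟨Matrix.of fun x y => (∏ j, if x j && y j then (-1 : ℂ) else 1) / (Real.sqrt (2 ^ m) : ℂ), by
    rw [Matrix.mem_unitaryGroup_iff]
    ext x y
    have hs : (Real.sqrt (2 ^ m) : ℂ) * (Real.sqrt (2 ^ m) : ℂ) = 2 ^ m := by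
      rw [← Complex.ofReal_mul, Real.mul_self_sqrt (by positivity)]
      push_cast
      rfl
    have key : ∑ z : BitString m, (∏ j, if x j && z j then (-1 : ℂ) else 1) *
        (∏ j, if y j && z j then (-1 : ℂ) else 1) = if x = y then 2 ^ m else 0 := by
      have h1 := (Fintype.prod_sum (fun (j : Fin m) (b : Bool) =>
        (if x j && b then (-1 : ℂ) else 1) * (if y j && b then (-1 : ℂ) else 1))).symm
      simp only [Finset.prod_mul_distrib] at h1
      refine h1.trans ?_
      split_ifs with hxy
      · subst hxy
        have : ∀ j, ∑ b : Bool, (if x j && b then (-1 : ℂ) else 1) *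
            (if x j && b then (-1 : ℂ) else 1) = 2 := by
          intro j
          cases x j <;> norm_num
        rw [Finset.prod_congr rfl fun j _ => this j]
        simp
      · obtain ⟨j, hj⟩ := Function.ne_iff.mp hxy
        refine Finset.prod_eq_zero (Finset.mem_univ j) ?_
        revert hj
        cases x j <;> cases y j <;> simp
    have hstar : ∀ z : BitString m, star (∏ j, if y j && z j then (-1 : ℂ) else 1) =
        ∏ j, if y j && z j then (-1 : ℂ) else 1 := by
      intro z
      rw [star_prod]
      refine Finset.prod_congr rfl fun j _ => ?_
      split_ifs <;> simp
    have hne : (2 : ℂ) ^ m ≠ 0 := pow_ne_zero _ two_ne_zero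
    simp only [Matrix.mul_apply, Matrix.star_apply, Matrix.of_apply, star_div₀, hstar,
      div_mul_div_comm, RCLike.star_def, Complex.conj_ofReal, hs, Matrix.one_apply]
    rw [← Finset.sum_div, key]
    split_ifs <;> simp [hne]⟩

/-- The quantum Fourier transform `|j⟩ ↦ M^{-1/2} ∑_l e^{2πijl/M} |l⟩`. -/
noncomputable def qft (M : ℕ) [NeZero M] : Matrix.unitaryGroup (Fin M) ℂ :=
  ⟨Matrix.of fun l j =>
      Complex.exp (2 * Real.pi * Complex.I * j * l / M) / (Real.sqrt M : ℂ), by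
    rw [Matrix.mem_unitaryGroup_iff]
    ext l l'
    have hM : (M : ℂ) ≠ 0 := Nat.cast_ne_zero.mpr (NeZero.ne M)
    have hs : (Real.sqrt M : ℂ) * (Real.sqrt M : ℂ) = M := by
      rw [← Complex.ofReal_mul, Real.mul_self_sqrt (by positivity)]
      push_cast
      rfl
    set z : ℂ := Complex.exp (2 * Real.pi * Complex.I * ((l : ℂ) - l') / M) with hz
    have hterm : ∀ j : Fin M, Complex.exp (2 * Real.pi * Complex.I * j * l / M) /
        (Real.sqrt M : ℂ) * star (Complex.exp (2 * Real.pi * Complex.I * j * l' / M) /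
        (Real.sqrt M : ℂ)) = z ^ (j : ℕ) / M := by
      intro j
      rw [star_div₀, RCLike.star_def, Complex.conj_ofReal, div_mul_div_comm, hs,
        ← Complex.exp_conj, ← Complex.exp_add, hz, ← Complex.exp_nat_mul]
      congr 2
      simp only [map_div₀, map_mul, Complex.conj_I, Complex.conj_ofReal, map_natCast, map_ofNat]
      ring
    simp only [Matrix.mul_apply, Matrix.star_apply, Matrix.of_apply, hterm, Matrix.one_apply]
    rw [← Finset.sum_div, Fin.sum_univ_eq_sum_range (fun j => z ^ j) M]
    split_ifs with h
    · subst h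
      simp [hz, hM]
    · have hz1 : z ≠ 1 := by
        intro h1
        obtain ⟨t, ht⟩ := Complex.exp_eq_one_iff.mp h1
        have h2 : ((l : ℂ) - l') = t * M := by
          field_simp at ht
          rw [ht, mul_comm]
        have h3 : ((l : ℕ) : ℤ) - (l' : ℕ) = t * M := by exact_mod_cast h2
        have hl := l.2
        have hl' := l'.2
        have ht0 : t = 0 := by
          have hMpos : (0 : ℤ) < M := by exact_mod_cast Nat.pos_of_ne_zero (NeZero.ne M)
          have a1 : t * M < 1 * M := by rw [← h3]; omega
          have a2 : (-1) * (M : ℤ) < t * M := by rw [← h3]; omega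
          have b1 := lt_of_mul_lt_mul_right a1 hMpos.le
          have b2 := lt_of_mul_lt_mul_right a2 hMpos.le
          omega
        rw [ht0] at h3
        exact h (Fin.ext (by omega))
      have hzM : z ^ M = 1 := by
        rw [hz, ← Complex.exp_nat_mul]
        have : (M : ℂ) * (2 * Real.pi * Complex.I * ((l : ℂ) - l') / M) =
            (((l : ℕ) : ℤ) - ((l' : ℕ) : ℤ) : ℤ) * (2 * Real.pi * Complex.I) := by
          push_cast
          field_simp
        rw [this, Complex.exp_int_mul_two_pi_mul_I]
      rw [geom_sum_eq hz1, hzM]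
      simp⟩

/-! ### Query circuits

A circuit acts on a work register with basis `W` and an `m`-bit register.  Its gates are
unitaries that do not depend on the oracle `g : {0,1}^m → {0,1}`, and (controlled) applications of
`Z_g`, each of which costs one query. -/

/-- A gate of a query circuit. -/
inductive Gate (W : Type) [Fintype W] [DecidableEq W] (m : ℕ) : Type
  /-- A unitary independent of the oracle. -/
  | unitary (U : Matrix.unitaryGroup (W × BitString m) ℂ) : Gate W m
  /-- `|w⟩|x⟩ ↦ (-1)^{g x}|w⟩|x⟩` if `c w` holds, and the identity on `|w⟩|x⟩` otherwise. -/
  | query (c : W → Bool) : Gate W m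

/-- A circuit: the head of the list is applied first. -/
abbrev Circuit (W : Type) [Fintype W] [DecidableEq W] (m : ℕ) : Type := List (Gate W m)

section Circuits

variable {W : Type} [Fintype W] [DecidableEq W] {m : ℕ}

/-- The unitary that a gate performs with oracle `g`. -/
noncomputable def Gate.eval (g : BitString m → Bool) : Gate W m → Matrix.unitaryGroup (W × BitString m) ℂ
  | .unitary U => U
  | .query c => signGate fun p => c p.1 && g p.2

/-- The number of queries of a gate. -/
def Gate.cost : Gate W m → ℕ
  | .unitary _ => 0
  | .query _ => 1

/-- The unitary that a circuit performs with oracle `g`. -/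
noncomputable def Circuit.eval (C : Circuit W m) (g : BitString m → Bool) :
    Matrix.unitaryGroup (W × BitString m) ℂ :=
  C.foldl (fun V γ => γ.eval g * V) 1

/-- The number of queries of a circuit. -/
def Circuit.cost (C : Circuit W m) : ℕ := (C.map Gate.cost).sum

end Circuits

/-- The oracle-independent part `-H^{⊗m} Z_0 H^{⊗m} = H^{⊗m} (2|0^m⟩⟨0^m| - I) H^{⊗m}` of the Grover
iterate, where `Z_0` changes the sign of `|0^m⟩` only. -/
noncomputable def diffusion (m : ℕ) : Matrix.unitaryGroup (BitString m) ℂ :=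
  -(hadamard m * signGate (fun x => decide (x = zeroString m)) * hadamard m)

/-! ### Grover's algorithm -/

/-- The number `⌊(π/4) √(2^m / b)⌋` of Grover iterations for a presumed number `b` of solutions. -/
noncomputable def groverIterations (m b : ℕ) : ℕ := ⌊Real.pi / 4 * Real.sqrt (2 ^ m / b)⌋₊

/-- Prepare the uniform superposition, then apply `G = -H^{⊗m} Z_0 H^{⊗m} Z_g` the given number of
times. No work register is used. -/
noncomputable def groverCircuit (m iterations : ℕ) : Circuit Unit m :=
  .unitary (tensor 1 (hadamard m)) ::
    (List.replicate iterations
      [Gate.query (fun _ => true), .unitary (tensor 1 (diffusion m))]).flatten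

/-- The string measured at the end of Grover's algorithm for `g` with presumed number of
solutions `b`. -/
noncomputable def groverOutcome {m : ℕ} (g : BitString m → Bool) (b : ℕ) : PMF (BitString m) :=
  (measure ((groverCircuit m (groverIterations m b)).eval g) ((), zeroString m)).map Prod.snd

/-! ### Quantum counting -/

/-- The circuit of `Count(H^{⊗m}, g, M)` on `|0⟩|0^m⟩`: the transforms `QFT_M ⊗ H^{⊗m}`, then
`|j⟩|ψ⟩ ↦ |j⟩ Q^j|ψ⟩` with `Q = H^{⊗m} (2|0^m⟩⟨0^m| - I) H^{⊗m} Z_g`, carried out by `M - 1`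
applications of `Q` of which the `l`-th (`1 ≤ l < M`) is controlled by `l ≤ j`, then
`QFT_M† ⊗ I`. -/
noncomputable def countCircuit (m M : ℕ) [NeZero M] : Circuit (Fin M) m :=
  .unitary (tensor (qft M) (hadamard m)) ::
    ((List.range (M - 1)).flatMap fun l =>
      [Gate.query (fun j : Fin M => decide (l + 1 ≤ (j : ℕ))),
        .unitary (controlled (fun j : Fin M => decide (l + 1 ≤ (j : ℕ))) (diffusion m))]) ++
    [.unitary (tensor (qft M)⁻¹ 1)]

/-- The value `y` found by measuring the first register at the end of `Count(H^{⊗m}, g, M)`. -/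
noncomputable def countOutcome {m : ℕ} (g : BitString m → Bool) (M : ℕ) [NeZero M] : PMF (Fin M) :=
  (measure ((countCircuit m M).eval g) (0, zeroString m)).map Prod.fst

/-- The integer estimate of the number of solutions: `2^m sin²(π y / M)`, rounded. -/
noncomputable def countEstimate (m : ℕ) {M : ℕ} (y : Fin M) : ℤ :=
  round ((2 : ℝ) ^ m * Real.sin (Real.pi * y / M) ^ 2)

/-- The parameter `⌈√(2^m)⌉` with which counting is used. -/
noncomputable def countParam (m : ℕ) : ℕ := ⌈Real.sqrt (2 ^ m)⌉₊

instance (m : ℕ) : NeZero (countParam m) :=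
  ⟨(Nat.ceil_pos.mpr (Real.sqrt_pos.mpr (by positivity))).ne'⟩

/-! ### The distributed algorithm -/

/-- The number of solutions of `g`. -/
def solutionCount {m : ℕ} (g : BitString m → Bool) : ℕ :=
  (Finset.univ.filter fun x => g x = true).card

/-- The string `x y_i` of length `n`: first the `n - k` bits of `x`, then the `k`-bit binary
representation `y_i` of `i`, most significant bit first. -/
def appendIndex {n k : ℕ} (x : BitString (n - k)) (i : Fin (2 ^ k)) : BitString n :=
  fun j => if h : (j : ℕ) < n - k then x ⟨j, h⟩ else (i : ℕ).testBit (n - 1 - j)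

/-- The subfunction `f_i(x) = f(x y_i)`. -/
def subfunction {n k : ℕ} (f : BitString n → Bool) (i : Fin (2 ^ k)) : BitString (n - k) → Bool :=
  fun x => f (appendIndex x i)

/-- `t_a = ⌈2π√a + 11⌉`. -/
noncomputable def countError (a : ℕ) : ℕ := ⌈2 * Real.pi * Real.sqrt a + 11⌉₊

/-- The nonzero possible numbers of solutions of a subfunction, for an estimate `c` that is correct
up to `t_a`: the numbers `1 ≤ b ≤ a` with `|b - c| ≤ t_a`. -/
noncomputable def possibleCounts (a : ℕ) (c : ℤ) : Finset ℕ :=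
  (Finset.Icc 1 a).filter fun b => |(b : ℤ) - c| ≤ countError a

/-- Run Grover's algorithm for the presumed numbers of solutions in the list, in this order; after
each measurement check the outcome `x` with one query, and end if `g x = 1`. The result is the
solution found, if any, and the number of queries. -/
noncomputable def groverSearch {m : ℕ} (g : BitString m → Bool) :
    List ℕ → PMF (Option (BitString m) × ℕ)
  | [] => PMF.pure (none, 0)
  | b :: bs => (groverOutcome g b).bind fun x =>
      let q := (groverCircuit m (groverIterations m b)).cost + 1
      if g x = true then PMF.pure (some x, q)
      else (groverSearch g bs).map fun r => (r.1, q + r.2)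

/-- The record of one execution of a machine: the numbers of solutions in its range, in the order
in which they are tried, the solution of `f` that was found, if any, and the number of queries. -/
structure Run (n : ℕ) : Type where
  candidates : List ℕ
  output : Option (BitString n)
  queries : ℕ

instance (n : ℕ) : MeasurableSpace (Run n) := ⊤

/-- Machine `M_i`: count the solutions of `f_i`; stop if `f_i` has no solution, otherwise search
with the candidates in the range that the measured value `y` determines, listed as `B y`. -/
noncomputable def machine {n k : ℕ} (f : BitString n → Bool) (i : Fin (2 ^ k))
    (B : Fin (countParam (n - k)) → List ℕ) : PMF (Run n) :=
  (countOutcome (subfunction f i) (countParam (n - k))).bind fun y =>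
    let q := (countCircuit (n - k) (countParam (n - k))).cost
    if solutionCount (subfunction f i) = 0 then PMF.pure ⟨[], none, q⟩
    else (groverSearch (subfunction f i) (B y)).map fun r =>
      ⟨B y, r.1.map fun x => appendIndex x i, q + r.2⟩

/-- The joint law of the `2^k` machines, which run independently in parallel. -/
noncomputable def parallelRun {n k : ℕ} (f : BitString n → Bool)
    (B : Fin (2 ^ k) → Fin (countParam (n - k)) → List ℕ) : Measure (Fin (2 ^ k) → Run n) :=
  Measure.pi fun i => (machine f i (B i)).toMeasure

/-- `P_{G_i} = sin²((2⌊π√(2^m) / (4√c)⌋ + 1) arcsin(√c / √(2^m)))`. -/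
noncomputable def groverProb (m c : ℕ) : ℝ :=
  Real.sin ((2 * (⌊Real.pi * Real.sqrt (2 ^ m) / (4 * Real.sqrt c)⌋₊ : ℝ) + 1) *
    Real.arcsin (Real.sqrt c / Real.sqrt (2 ^ m))) ^ 2

/-- `∑_{b} ⌊(π/4) √(2^m / b)⌋ + ⌈√(2^m)⌉ + 2 t_a + 1`, the sum being over the list `bs`. -/
noncomputable def queryBound (m a : ℕ) (bs : List ℕ) : ℕ :=
  (bs.map fun b : ℕ => ⌊Real.pi / 4 * Real.sqrt (2 ^ m / b)⌋₊).sum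
    + ⌈Real.sqrt (2 ^ m)⌉₊ + 2 * countError a + 1

end DistGrover

open DistGrover

/-! Write `g` for the subfunction, with `a_i ≥ 1` solutions among `N` strings, and `sin θ =
√(a_i/N)`. The Grover iterate rotates the plane of states that are constant on solutions and on
non-solutions by `2θ`, so `t` iterations give the amplitudes in `groverState` (`groverState_succ`).
Summing squares over the solutions gives `P_G`.

On that plane the iterate has eigenvalues `e^{±2iθ}`, so counting is phase estimation: the law of
`y` is the average of the phase-estimation laws for `θ` and `-θ` (`countOutcome_sum`). Each gives
mass at least `8/π²` to the two grid points next to the true phase (`le_sum_phaseProb`), by an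
elementary inequality for the sine (`eight_mul_le_sin_sq`). For those `y`, as `M ≥ √N`, the estimate
is off by at most `2π√a_i + π² + 1/2 ≤ t_a` (`abs_sub_countEstimate_le`), so `a_i` is among the
candidates.

Trying further candidates cannot lower the chance of success below that of the run with `b = a_i`
(`le_groverSearch_toOuterMeasure`); multiplying the two probabilities gives the third claim. The
bounds of the second claim hold on every execution path, by adding up costs. -/

namespace DistGrover

/-! ### Evolution of the state and query costs -/

section Evolution

variable {W : Type} [Fintype W] [DecidableEq W] {m : ℕ}

theorem Circuit.eval_nil (g : BitString m → Bool) : Circuit.eval ([] : Circuit W m) g = 1 := rfl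

theorem Circuit.eval_append (C D : Circuit W m) (g : BitString m → Bool) :
    Circuit.eval (C ++ D) g = Circuit.eval D g * Circuit.eval C g := by
  have key : ∀ (D : Circuit W m) (V : Matrix.unitaryGroup (W × BitString m) ℂ),
      D.foldl (fun V γ => γ.eval g * V) V = D.foldl (fun V γ => γ.eval g * V) 1 * V := by
    intro D
    induction D with
    | nil => intro V; simp
    | cons γ D ih =>
      intro V
      simp only [List.foldl_cons]
      rw [ih, ih (γ.eval g * 1), mul_one, mul_assoc]
  rw [Circuit.eval, List.foldl_append, key]
  rfl

theorem Circuit.eval_singleton (γ : Gate W m) (g : BitString m → Bool) :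
    Circuit.eval [γ] g = γ.eval g := by
  simp [Circuit.eval]

theorem Circuit.eval_cons (γ : Gate W m) (C : Circuit W m) (g : BitString m → Bool) :
    Circuit.eval (γ :: C) g = Circuit.eval C g * γ.eval g := by
  rw [← List.singleton_append, Circuit.eval_append, Circuit.eval_singleton]

theorem Circuit.cost_append (C D : Circuit W m) :
    Circuit.cost (C ++ D) = Circuit.cost C + Circuit.cost D := by
  simp [Circuit.cost]

theorem Circuit.cost_cons (γ : Gate W m) (C : Circuit W m) :
    Circuit.cost (γ :: C) = γ.cost + Circuit.cost C := by
  simp [Circuit.cost]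

theorem Circuit.cost_flatMap_of_forall {α : Type} (l : List α) (F : α → Circuit W m) (c : ℕ)
    (hF : ∀ x, Circuit.cost (F x) = c) : Circuit.cost (l.flatMap F) = l.length * c := by
  induction l with
  | nil => simp [Circuit.cost]
  | cons x l ih => rw [List.flatMap_cons, Circuit.cost_append, ih, hF, List.length_cons]; ring

theorem hadamard_apply_zero (x : BitString m) :
    (hadamard m).1 x (zeroString m) = 1 / (Real.sqrt (2 ^ m) : ℂ) := by
  simp [hadamard, zeroString]

theorem hadamard_zero_apply (x : BitString m) :
    (hadamard m).1 (zeroString m) x = 1 / (Real.sqrt (2 ^ m) : ℂ) := by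
  simp [hadamard, zeroString]

theorem star_hadamard : star (hadamard m).1 = (hadamard m).1 := by
  ext x y
  simp only [Matrix.star_apply, hadamard, Matrix.of_apply, star_div₀, star_prod, RCLike.star_def,
    Complex.conj_ofReal]
  congr 1
  refine Finset.prod_congr rfl fun j _ => ?_
  rw [Bool.and_comm]
  split_ifs <;> simp

theorem hadamard_mul_self : (hadamard m).1 * (hadamard m).1 = 1 := by
  have := Matrix.mem_unitaryGroup_iff.mp (hadamard m).2
  rwa [star_hadamard] at this

/-- Since `Z_0 = 1 - 2|0⟩⟨0|` and `H² = 1`, the operator is the reflection `2|s⟩⟨s| - 1`, where all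
entries of `|s⟩` are `1/√N`. -/
theorem diffusion_apply (x y : BitString m) :
    (diffusion m).1 x y = 2 / 2 ^ m - if x = y then 1 else 0 := by
  have hs : (Real.sqrt (2 ^ m) : ℂ) * (Real.sqrt (2 ^ m) : ℂ) = 2 ^ m := by
    rw [← Complex.ofReal_mul, Real.mul_self_sqrt (by positivity)]
    push_cast
    rfl
  have hD : (signGate fun x : BitString m => decide (x = zeroString m)).1 =
      1 - 2 • Matrix.single (zeroString m) (zeroString m) (1 : ℂ) := by
    ext u v
    by_cases huv : u = v
    · subst huv
      by_cases h0 : u = zeroString m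
      · subst h0; simp [signGate]; norm_num
      · simp [signGate, h0, Ne.symm h0]
    · have : ¬ (zeroString m = u ∧ zeroString m = v) := fun h => huv (h.1.symm.trans h.2)
      simp [signGate, huv, this]
  have : (diffusion m).1 = -((hadamard m).1 *
      (signGate fun x : BitString m => decide (x = zeroString m)).1 * (hadamard m).1) := rfl
  rw [this, hD, mul_sub, sub_mul, mul_one, hadamard_mul_self, Matrix.neg_apply, Matrix.sub_apply,
    Matrix.one_apply]
  have h2 : ((hadamard m).1 * (2 • Matrix.single (zeroString m) (zeroString m) (1 : ℂ)) *
      (hadamard m).1) x y = 2 / 2 ^ m := by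
    rw [mul_smul_comm, smul_mul_assoc, Matrix.smul_apply, Matrix.mul_apply,
      Finset.sum_eq_single (zeroString m)]
    · rw [Matrix.mul_single_apply_same, hadamard_apply_zero, hadamard_zero_apply, mul_one,
        div_mul_div_comm, hs]
      simp [div_eq_mul_inv]
    · intro z _ hz
      rw [Matrix.mul_single_apply_of_ne]
      · simp
      · exact hz
    · simp
  rw [h2]
  ring

theorem diffusion_mulVec (v : BitString m → ℂ) (x : BitString m) :
    ((diffusion m).1.mulVec v) x = 2 / 2 ^ m * ∑ y, v y - v x := by
  simp [Matrix.mulVec, dotProduct, diffusion_apply, sub_mul, Finset.sum_sub_distrib,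
    Finset.mul_sum]

/-- Makes a plain Grover iteration a controlled one, so that one computation serves both circuits.
-/
theorem tensor_one_eq_controlled (V : Matrix.unitaryGroup (BitString m) ℂ) :
    tensor (1 : Matrix.unitaryGroup W ℂ) V = controlled (fun _ => true) V := by
  ext ⟨w, x⟩ ⟨w', x'⟩
  simp [tensor, controlled, Matrix.one_apply]

theorem controlled_mulVec (c : W → Bool) (V : Matrix.unitaryGroup (BitString m) ℂ)
    (v : W × BitString m → ℂ) (w : W) (x : BitString m) :
    ((controlled c V).1.mulVec v) (w, x) =
      if c w then (V.1.mulVec fun y => v (w, y)) x else v (w, x) := by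
  by_cases h : c w <;>
  simp [controlled, Matrix.mulVec, dotProduct, Fintype.sum_prod_type, h, Matrix.one_apply]

theorem tensor_mulVec (U : Matrix.unitaryGroup W ℂ) (V : Matrix.unitaryGroup (BitString m) ℂ)
    (v : W × BitString m → ℂ) (w : W) (x : BitString m) :
    ((tensor U V).1.mulVec v) (w, x) = ∑ w', ∑ y, U.1 w w' * V.1 x y * v (w', y) := by
  simp [tensor, Matrix.mulVec, dotProduct, Fintype.sum_prod_type]

theorem signGate_mulVec {ι : Type} [Fintype ι] [DecidableEq ι] (c : ι → Bool) (v : ι → ℂ) (p : ι) :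
    ((signGate c).1.mulVec v) p = if c p then -v p else v p := by
  by_cases h : c p <;> simp [signGate, Matrix.mulVec_diagonal, h]

/-- The angle `arcsin √(a/N)` of the uniform superposition, for the number `a` of solutions. -/
noncomputable def groverAngle (g : BitString m → Bool) : ℝ :=
  Real.arcsin (Real.sqrt (solutionCount g) / Real.sqrt (2 ^ m))

/-- The state after `t` Grover iterations. -/
noncomputable def groverState (g : BitString m → Bool) (t : ℕ) (x : BitString m) : ℝ :=
  if g x then Real.sin ((2 * t + 1) * groverAngle g) / Real.sqrt (solutionCount g)
  else Real.cos ((2 * t + 1) * groverAngle g) / Real.sqrt (2 ^ m - solutionCount g)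

theorem solutionCount_le (g : BitString m → Bool) : solutionCount g ≤ 2 ^ m := by
  refine (Finset.card_le_univ _).trans ?_
  simp

theorem solutionCount_le_real (g : BitString m → Bool) : (solutionCount g : ℝ) ≤ 2 ^ m := by
  exact_mod_cast solutionCount_le g

theorem card_nonsolutions (g : BitString m → Bool) :
    ((Finset.univ.filter fun x => ¬ g x = true).card : ℝ) = 2 ^ m - solutionCount g := by
  have h := Finset.card_filter_add_card_filter_not (s := (Finset.univ : Finset (BitString m)))
    (fun x => g x = true)
  have h2 : (Finset.univ : Finset (BitString m)).card = 2 ^ m := by simp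
  rw [h2] at h
  have h3 : ((Finset.univ.filter fun x => g x = true).card : ℝ) +
    (Finset.univ.filter fun x => ¬ g x = true).card = 2 ^ m := by exact_mod_cast h
  unfold solutionCount
  linarith

theorem sum_ite_solution (g : BitString m → Bool) (A B : ℝ) :
    ∑ x, (if g x then A else B) = solutionCount g * A + (2 ^ m - solutionCount g) * B := by
  rw [Finset.sum_ite, Finset.sum_const, Finset.sum_const, ← card_nonsolutions]
  simp [solutionCount]

theorem sin_groverAngle (g : BitString m → Bool) :
    Real.sin (groverAngle g) = Real.sqrt (solutionCount g) / Real.sqrt (2 ^ m) := by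
  refine Real.sin_arcsin ?_ ?_
  · have : 0 ≤ Real.sqrt (solutionCount g) / Real.sqrt (2 ^ m) := by positivity
    linarith
  · rw [div_le_one (by positivity)]
    exact Real.sqrt_le_sqrt (solutionCount_le_real g)

theorem cos_groverAngle (g : BitString m → Bool) :
    Real.cos (groverAngle g) = Real.sqrt (2 ^ m - solutionCount g) / Real.sqrt (2 ^ m) := by
  rw [groverAngle, Real.cos_arcsin, div_pow, Real.sq_sqrt (by positivity),
    Real.sq_sqrt (by positivity),
    ← Real.sqrt_div (sub_nonneg.mpr (solutionCount_le_real g))]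
  congr 1
  field_simp

theorem groverState_zero (g : BitString m → Bool) (hg : 1 ≤ solutionCount g) (x : BitString m) :
    groverState g 0 x = 1 / Real.sqrt (2 ^ m) := by
  have hN : Real.sqrt (2 ^ m) ≠ 0 := by positivity
  by_cases h : g x
  · have : Real.sqrt (solutionCount g) ≠ 0 := by
      have : (0 : ℝ) < solutionCount g := by exact_mod_cast hg
      positivity
    simp only [groverState, h, if_true, Nat.cast_zero, mul_zero, zero_add, one_mul, sin_groverAngle]
    field_simp
  -- The string `x` is itself a non-solution, so the denominator does not vanish.
  · have : (0 : ℝ) < 2 ^ m - solutionCount g := by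
      rw [← card_nonsolutions]
      exact_mod_cast Finset.card_pos.mpr ⟨x, by simpa using h⟩
    have : Real.sqrt (2 ^ m - solutionCount g) ≠ 0 := by positivity
    have h' : g x = false := by simpa using h
    simp only [groverState, h', Bool.false_eq_true, if_false, Nat.cast_zero, mul_zero, zero_add,
      one_mul, cos_groverAngle]
    field_simp

/-- After the sign flip the mean amplitude is `cos((2t+2)θ)/√N`. Reflecting in the mean then amounts
to the sum formulas for `sin(A+θ) - sin(A-θ)` and `cos(A+θ) + cos(A-θ)` with `A = (2t+2)θ`. -/
theorem groverState_succ (g : BitString m → Bool) (hg : 1 ≤ solutionCount g) (t : ℕ)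
    (x : BitString m) :
    2 / 2 ^ m * ∑ y, (if g y then -groverState g t y else groverState g t y) -
      (if g x then -groverState g t x else groverState g t x) = groverState g (t + 1) x := by
  have hN : 0 < Real.sqrt (2 ^ m) := by positivity
  have ha : 0 < Real.sqrt (solutionCount g) := by
    have : (0 : ℝ) < solutionCount g := by exact_mod_cast hg
    positivity
  set θ := groverAngle g with hθ
  have hb : (0 : ℝ) ≤ 2 ^ m - solutionCount g := sub_nonneg.mpr (solutionCount_le_real g)
  have hsum : ∑ y, (if g y then -groverState g t y else groverState g t y) =
      Real.sqrt (2 ^ m) * Real.cos ((2 * t + 2) * θ) := by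
    have h1 : ∀ y, (if g y then -groverState g t y else groverState g t y) =
        if g y then -(Real.sin ((2 * t + 1) * θ) / Real.sqrt (solutionCount g)) else
          Real.cos ((2 * t + 1) * θ) / Real.sqrt (2 ^ m - solutionCount g) := by
      intro y
      by_cases h : g y <;> simp [groverState, h, hθ]
    -- True also at `r = 0`, which covers the case where every string is a solution.
    have hd : ∀ r c : ℝ, 0 ≤ r → r * (c / Real.sqrt r) = c * Real.sqrt r := by
      intro r c _
      rw [mul_div_assoc', mul_comm, mul_div_assoc, Real.div_sqrt]
    simp only [h1]
    rw [sum_ite_solution]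
    rw [mul_neg, hd _ _ (by positivity), hd _ _ hb,
      show (2 * (t : ℝ) + 2) * θ = (2 * t + 1) * θ + θ by ring, Real.cos_add, hθ,
      sin_groverAngle, cos_groverAngle]
    field_simp
    ring
  rw [hsum]
  have hNN : (2 : ℝ) ^ m = Real.sqrt (2 ^ m) * Real.sqrt (2 ^ m) :=
    (Real.mul_self_sqrt (by positivity)).symm
  have e1 : (2 * (t : ℝ) + 1) * θ = (2 * t + 2) * θ - θ := by ring
  have e2 : (2 * ((t + 1 : ℕ) : ℝ) + 1) * θ = (2 * t + 2) * θ + θ := by push_cast; ring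
  have hc : 2 / 2 ^ m * (Real.sqrt (2 ^ m) * Real.cos ((2 * t + 2) * θ)) =
      2 * Real.cos ((2 * t + 2) * θ) / Real.sqrt (2 ^ m) := by
    rw [div_mul_eq_mul_div, div_eq_div_iff (by positivity) hN.ne']
    linear_combination (-2 * Real.cos ((2 * t + 2) * θ)) * hNN
  rw [hc]
  by_cases h : g x
  · simp only [groverState, h, if_true, ← hθ, e1, e2, Real.sin_add, Real.sin_sub]
    have := sin_groverAngle g
    rw [← hθ] at this
    rw [this]
    field_simp
    ring
  · have : (0 : ℝ) < 2 ^ m - solutionCount g := by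
      rw [← card_nonsolutions]
      exact_mod_cast Finset.card_pos.mpr ⟨x, by simpa using h⟩
    have hb' : Real.sqrt (2 ^ m - solutionCount g) ≠ 0 := by positivity
    have h' : g x = false := by simpa using h
    simp only [groverState, h', ← hθ, e1, e2, Real.cos_add, Real.cos_sub, Bool.false_eq_true,
      if_false]
    have := cos_groverAngle g
    rw [← hθ] at this
    rw [this]
    field_simp
    ring

/-- The state `∑ w, q w |w⟩ G^{t w}|s⟩` with `|s⟩` the uniform superposition. -/
noncomputable def branchState (g : BitString m → Bool) (q : W → ℂ) (t : W → ℕ)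
    (p : W × BitString m) : ℂ := q p.1 * groverState g (t p.1) p.2

/-- A controlled Grover iteration. -/
noncomputable def groverStep (m : ℕ) (c : W → Bool) : Circuit W m :=
  [Gate.query c, .unitary (controlled c (diffusion m))]

theorem groverStep_mulVec (g : BitString m → Bool) (hg : 1 ≤ solutionCount g) (c : W → Bool)
    (q : W → ℂ) (t : W → ℕ) :
    ((groverStep m c).eval g).1.mulVec (branchState g q t) =
      branchState g q fun w => t w + if c w then 1 else 0 := by
  rw [groverStep, Circuit.eval_cons, Circuit.eval_singleton]
  simp only [Gate.eval, Submonoid.coe_mul, ← Matrix.mulVec_mulVec]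
  ext ⟨w, x⟩
  rw [controlled_mulVec]
  by_cases h : c w
  · simp only [h, if_true, diffusion_mulVec, signGate_mulVec, Bool.true_and, branchState]
    rw [← groverState_succ g hg]
    push_cast
    have hy : ∀ y, (if g y then -(q w * groverState g (t w) y) else q w * groverState g (t w) y) =
        q w * if g y then -(groverState g (t w) y : ℂ) else groverState g (t w) y := by
      intro y; split_ifs <;> ring
    have hy' : ∀ y, (((if g y then -groverState g (t w) y else groverState g (t w) y) : ℝ) : ℂ) =
        if g y then -(groverState g (t w) y : ℂ) else groverState g (t w) y := by
      intro y; split_ifs <;> simp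
    simp only [hy, hy', ← Finset.mul_sum]
    ring
  · simp [h, signGate_mulVec, branchState]

/-- The branches of the work register never mix; each advances once for every control that fires in
it. -/
theorem flatMap_groverStep_mulVec (g : BitString m → Bool) (hg : 1 ≤ solutionCount g) {α : Type}
    (l : List α) (c : α → W → Bool) (q : W → ℂ) (t : W → ℕ) :
    (Circuit.eval (l.flatMap fun i => groverStep m (c i)) g).1.mulVec (branchState g q t) =
      branchState g q fun w => t w + l.countP fun i => c i w := by
  induction l generalizing t with
  | nil => simp [Circuit.eval_nil]
  | cons i l ih =>
    rw [List.flatMap_cons, Circuit.eval_append, Submonoid.coe_mul, ← Matrix.mulVec_mulVec,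
      groverStep_mulVec g hg, ih]
    congr 1
    ext w
    rw [List.countP_cons]
    ring

theorem tensor_hadamard_mulVec (g : BitString m → Bool) (hg : 1 ≤ solutionCount g)
    (U : Matrix.unitaryGroup W ℂ) (w : W) :
    (tensor U (hadamard m)).1.mulVec (Pi.single (w, zeroString m) 1) =
      branchState g (fun w' => U.1 w' w) fun _ => 0 := by
  ext ⟨w', x⟩
  rw [Matrix.mulVec_single_one]
  simp [tensor, branchState, groverState_zero g hg, hadamard_apply_zero]

theorem groverCircuit_apply (g : BitString m → Bool) (hg : 1 ≤ solutionCount g) (t : ℕ)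
    (x : BitString m) :
    ((groverCircuit m t).eval g).1 ((), x) ((), zeroString m) = groverState g t x := by
  have hC : groverCircuit m t = .unitary (tensor 1 (hadamard m)) ::
      (List.range t).flatMap fun _ => groverStep m fun _ : Unit => true := by
    simp [groverCircuit, groverStep, tensor_one_eq_controlled, List.flatMap]
  have h : ((groverCircuit m t).eval g).1.mulVec (Pi.single ((), zeroString m) 1) ((), x) =
      groverState g t x := by
    rw [hC, Circuit.eval_cons, Submonoid.coe_mul, ← Matrix.mulVec_mulVec, Gate.eval,
      tensor_hadamard_mulVec g hg, flatMap_groverStep_mulVec g hg]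
    simp [branchState]
  rwa [Matrix.mulVec_single_one] at h

theorem groverCircuit_cost (m t : ℕ) : (groverCircuit m t).cost = t := by
  have hC : groverCircuit m t = .unitary (tensor 1 (hadamard m)) ::
      (List.range t).flatMap fun _ => groverStep m fun _ : Unit => true := by
    simp [groverCircuit, groverStep, tensor_one_eq_controlled, List.flatMap]
  rw [hC, Circuit.cost_cons, Circuit.cost_flatMap_of_forall (c := 1)]
  · simp [Gate.cost]
  · simp [Circuit.cost, groverStep, Gate.cost]

theorem countCircuit_eq (m M : ℕ) [NeZero M] : countCircuit m M =
    (.unitary (tensor (qft M) (hadamard m)) ::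
      (List.range (M - 1)).flatMap fun l => groverStep m fun j : Fin M => decide (l + 1 ≤ (j : ℕ)))
      ++ [.unitary (tensor (qft M)⁻¹ 1)] := rfl

theorem countCircuit_cost (m M : ℕ) [NeZero M] : (countCircuit m M).cost = M - 1 := by
  rw [countCircuit_eq, Circuit.cost_append, Circuit.cost_cons,
    Circuit.cost_flatMap_of_forall (c := 1)]
  · simp [Circuit.cost, Gate.cost]
  · simp [Circuit.cost, groverStep, Gate.cost]

/-- Branch `j` of the counting circuit thus receives exactly `G^j`, although only `M - 1` controlled
steps are made. -/
theorem countP_range_succ_le (M j : ℕ) (hj : j < M) :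
    (List.range (M - 1)).countP (fun l => decide (l + 1 ≤ j)) = j := by
  have key : ∀ K, (List.range K).countP (fun l => decide (l + 1 ≤ j)) = min K j := by
    intro K
    induction K with
    | zero => simp
    | succ K ih =>
      rw [List.range_succ, List.countP_append, ih, List.countP_singleton]
      simp only [decide_eq_true_eq]
      split_ifs <;> omega
  rw [key]
  omega

theorem countCircuit_apply (g : BitString m → Bool) (hg : 1 ≤ solutionCount g) (M : ℕ) [NeZero M]
    (y : Fin M) (x : BitString m) :
    ((countCircuit m M).eval g).1 (y, x) (0, zeroString m) =
      1 / M * ∑ j : Fin M, Complex.exp (-(2 * Real.pi * Complex.I * j * y / M)) *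
        groverState g j x := by
  have hs : (Real.sqrt M : ℂ) * (Real.sqrt M : ℂ) = M := by
    rw [← Complex.ofReal_mul, Real.mul_self_sqrt (by positivity)]
    push_cast
    rfl
  have h : ((countCircuit m M).eval g).1.mulVec (Pi.single (0, zeroString m) 1) (y, x) =
      1 / M * ∑ j : Fin M, Complex.exp (-(2 * Real.pi * Complex.I * j * y / M)) *
        groverState g j x := by
    rw [countCircuit_eq, Circuit.eval_append, Circuit.eval_singleton, Circuit.eval_cons,
      Submonoid.coe_mul, Submonoid.coe_mul, ← Matrix.mulVec_mulVec, ← Matrix.mulVec_mulVec,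
      Gate.eval, Gate.eval, tensor_hadamard_mulVec g hg, flatMap_groverStep_mulVec g hg,
      tensor_mulVec, Finset.mul_sum]
    refine Finset.sum_congr rfl fun j _ => ?_
    have hinv : ((qft M)⁻¹).1 y j =
        Complex.exp (-(2 * Real.pi * Complex.I * j * y / M)) / (Real.sqrt M : ℂ) := by
      rw [Matrix.UnitaryGroup.inv_val, Matrix.star_apply]
      simp only [qft, Matrix.of_apply, star_div₀, RCLike.star_def, Complex.conj_ofReal]
      rw [← Complex.exp_conj]
      congr 2
      simp only [map_div₀, map_mul, Complex.conj_I, Complex.conj_ofReal, map_natCast, map_ofNat]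
      ring
    rw [Finset.sum_eq_single x]
    · have hq : (qft M).1 j 0 = 1 / (Real.sqrt M : ℂ) := by simp [qft]
      simp only [branchState, countP_range_succ_le M j j.2, hinv, hq, zero_add,
        Submonoid.coe_one, Matrix.one_apply_eq]
      rw [show (1 : ℂ) / M = 1 / ((Real.sqrt M : ℂ) * (Real.sqrt M : ℂ)) by rw [hs]]
      ring
    · intro z _ hz
      simp [Ne.symm hz]
    · simp
  rwa [Matrix.mulVec_single_one] at h

end Evolution

end DistGrover

namespace DistGrover

/-! ### Success probability and accuracy of phase estimation -/

section PhaseEstimation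

/-- Equality holds at `δ = 1/2`, so the range is split: near `0` there is slack (`π²` against `8`)
and a cubic bound for the sine suffices; elsewhere the cosine is expanded about the midpoint. -/
theorem eight_mul_le_sin_sq_of_le_half {δ : ℝ} (h0 : 0 ≤ δ) (h1 : δ ≤ 1 / 2) :
    8 * (δ ^ 2 * (1 - δ) ^ 2) ≤ Real.sin (Real.pi * δ) ^ 2 * (δ ^ 2 + (1 - δ) ^ 2) := by
  have hp1 := Real.pi_gt_d4
  have hp2 := Real.pi_lt_d4
  have hP1 : 9.869 ≤ Real.pi ^ 2 := by nlinarith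
  have hP2 : Real.pi ^ 2 ≤ 9.87 := by nlinarith
  rcases le_total δ 0.21 with h | h
  · rcases h0.eq_or_lt with rfl | hpos
    · simp
    have hsin := (Real.sin_gt_sub_cube (by positivity : 0 < Real.pi * δ)).le
    have hs : δ ^ 2 ≤ 0.0441 := by nlinarith
    have hlow : 1 - 2.4675 * δ ^ 2 ≤ 1 - Real.pi ^ 2 * δ ^ 2 / 6 := by
      nlinarith [sq_nonneg δ]
    have hlow0 : 0 ≤ 1 - 2.4675 * δ ^ 2 := by linarith
    have hsin2 : Real.pi * δ * (1 - 2.4675 * δ ^ 2) ≤ Real.sin (Real.pi * δ) := by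
      refine le_trans (mul_le_mul_of_nonneg_left hlow (by positivity)) (le_trans (le_of_eq ?_) hsin)
      ring
    have hsq : (Real.pi * δ * (1 - 2.4675 * δ ^ 2)) ^ 2 ≤ Real.sin (Real.pi * δ) ^ 2 :=
      pow_le_pow_left₀ (by positivity) hsin2 2
    -- Allows the factor `(1 - δ)²` to cancel, leaving an inequality in `δ²` alone.
    have hden : (1 - δ) ^ 2 * (1 + δ ^ 2) ≤ δ ^ 2 + (1 - δ) ^ 2 := by
      have : (1 - δ) ^ 2 ≤ 1 := by nlinarith
      nlinarith [sq_nonneg δ]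
    have hnum : 8 ≤ Real.pi ^ 2 * ((1 - 2.4675 * δ ^ 2) ^ 2 * (1 + δ ^ 2)) := by
      have hs0 : 0 ≤ δ ^ 2 := sq_nonneg δ
      generalize δ ^ 2 = s at hs hs0
      have h3 : 0.815 ≤ (1 - 2.4675 * s) ^ 2 * (1 + s) := by
        nlinarith [mul_nonneg hs0 hs0, mul_nonneg hs0 (mul_nonneg hs0 hs0)]
      nlinarith
    calc 8 * (δ ^ 2 * (1 - δ) ^ 2)
        ≤ Real.pi ^ 2 * ((1 - 2.4675 * δ ^ 2) ^ 2 * (1 + δ ^ 2)) * (δ ^ 2 * (1 - δ) ^ 2) :=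
          mul_le_mul_of_nonneg_right hnum (by positivity)
      _ = (Real.pi * δ * (1 - 2.4675 * δ ^ 2)) ^ 2 * ((1 - δ) ^ 2 * (1 + δ ^ 2)) := by ring
      _ ≤ _ := mul_le_mul hsq hden (by positivity) (by positivity)
  · obtain ⟨u, hu⟩ : ∃ u, δ = 1 / 2 - u := ⟨1 / 2 - δ, by ring⟩
    have hcos : Real.sin (Real.pi * δ) = Real.cos (Real.pi * u) := by
      rw [hu, show Real.pi * (1 / 2 - u) = Real.pi / 2 - Real.pi * u by ring,
        Real.sin_pi_div_two_sub]
    have hr : u ^ 2 ≤ 0.0841 := by nlinarith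
    have hr0 : 0 ≤ u ^ 2 := sq_nonneg u
    have hc := Real.one_sub_sq_div_two_le_cos (x := Real.pi * u)
    have hc2 : 1 - 4.935 * u ^ 2 ≤ Real.cos (Real.pi * u) := by
      refine le_trans ?_ hc
      rw [mul_pow]
      nlinarith
    have hsq : (1 - 4.935 * u ^ 2) ^ 2 ≤ Real.cos (Real.pi * u) ^ 2 :=
      pow_le_pow_left₀ (by linarith) hc2 2
    have e1 : δ ^ 2 * (1 - δ) ^ 2 = (1 / 4 - u ^ 2) ^ 2 := by rw [hu]; ring
    have e2 : δ ^ 2 + (1 - δ) ^ 2 = 1 / 2 + 2 * u ^ 2 := by rw [hu]; ring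
    rw [e1, e2, hcos]
    refine le_trans ?_ (mul_le_mul_of_nonneg_right hsq (by positivity))
    generalize u ^ 2 = r at hr hr0
    -- The constant terms of the two sides agree, and their difference is, up to rounding, `r` times
    -- this quadratic. Its smaller root is about `0.099`, beyond `0.0841 = (1/2 - 0.21)²`.
    have hq : 0 ≤ 1.065 - 15.561 * r + 48.7 * r ^ 2 := by nlinarith [sq_nonneg (0.0841 - r)]
    nlinarith [mul_nonneg hr0 hq, mul_nonneg hr0 (mul_nonneg hr0 hr0)]

theorem eight_mul_le_sin_sq {δ : ℝ} (h0 : 0 ≤ δ) (h1 : δ ≤ 1) :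
    8 * (δ ^ 2 * (1 - δ) ^ 2) ≤ Real.sin (Real.pi * δ) ^ 2 * (δ ^ 2 + (1 - δ) ^ 2) := by
  rcases le_total δ (1 / 2) with h | h
  · exact eight_mul_le_sin_sq_of_le_half h0 h
  · have := eight_mul_le_sin_sq_of_le_half (δ := 1 - δ) (by linarith) (by linarith)
    rw [show Real.pi * (1 - δ) = Real.pi - Real.pi * δ by ring, Real.sin_pi_sub] at this
    calc _ = 8 * ((1 - δ) ^ 2 * (1 - (1 - δ)) ^ 2) := by ring
      _ ≤ _ := this
      _ = _ := by ring

/-- `|M⁻¹ ∑_{j < M} e^{2ijα}|²`. -/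
noncomputable def phaseProb (M : ℕ) (α : ℝ) : ℝ :=
  ‖∑ j ∈ Finset.range M, Complex.exp (2 * α * Complex.I) ^ j‖ ^ 2 / M ^ 2

theorem phaseProb_nonneg (M : ℕ) (α : ℝ) : 0 ≤ phaseProb M α := by
  unfold phaseProb; positivity

theorem phaseProb_add_int_mul_pi (M : ℕ) (α : ℝ) (q : ℤ) :
    phaseProb M (α + q * Real.pi) = phaseProb M α := by
  have : Complex.exp (2 * ((α + q * Real.pi : ℝ) : ℂ) * Complex.I) =
      Complex.exp (2 * α * Complex.I) := by
    rw [← Complex.exp_periodic.int_mul q (2 * α * Complex.I)]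
    congr 1
    push_cast
    ring
  rw [phaseProb, this, phaseProb]

theorem phaseProb_zero (M : ℕ) (hM : M ≠ 0) : phaseProb M 0 = 1 := by
  simp [phaseProb, hM]

theorem norm_exp_two_mul_sub_one (α : ℝ) :
    ‖Complex.exp (2 * α * Complex.I) - 1‖ = 2 * |Real.sin α| := by
  have := Complex.norm_exp_I_mul_ofReal_sub_one (2 * α)
  rw [show Complex.I * ((2 * α : ℝ) : ℂ) = 2 * α * Complex.I by push_cast; ring] at this
  rw [this, Real.norm_eq_abs, abs_mul, abs_two]
  congr 3
  ring

/-- The geometric sum evaluates to `sin²(Mα) / (M sin α)²`, and `|sin α| ≤ |α|`. -/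
theorem le_phaseProb (M : ℕ) (hM : M ≠ 0) {α : ℝ} (h0 : α ≠ 0) (h1 : |α| < Real.pi) :
    Real.sin (M * α) ^ 2 / (M * α) ^ 2 ≤ phaseProb M α := by
  have hs : Real.sin α ≠ 0 := by
    intro h
    rw [Real.sin_eq_zero_iff_of_lt_of_lt (by linarith [neg_abs_le α]) (by linarith [le_abs_self α])]
      at h
    exact h0 h
  have hne : Complex.exp (2 * α * Complex.I) ≠ 1 := by
    intro h
    have := norm_exp_two_mul_sub_one α
    rw [h, sub_self, norm_zero] at this
    exact hs (abs_eq_zero.mp (by linarith))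
  have hpow : Complex.exp (2 * α * Complex.I) ^ M = Complex.exp (2 * (M * α : ℝ) * Complex.I) := by
    rw [← Complex.exp_nat_mul]
    congr 1
    push_cast
    ring
  rw [phaseProb, geom_sum_eq hne, hpow, norm_div, norm_exp_two_mul_sub_one,
    norm_exp_two_mul_sub_one, mul_div_mul_left _ _ two_ne_zero, div_pow, sq_abs, sq_abs, div_div]
  have hM' : (0 : ℝ) < M := by exact_mod_cast Nat.pos_of_ne_zero hM
  refine div_le_div_of_nonneg_left (sq_nonneg _) (by positivity) ?_
  rw [mul_pow, mul_comm]
  refine mul_le_mul_of_nonneg_left ?_ (by positivity)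
  rw [← sq_abs (Real.sin α), ← sq_abs α]
  exact pow_le_pow_left₀ (abs_nonneg _) Real.abs_sin_le_abs 2

/-- The true phase lies `δ` above one grid point and `1 - δ` below the next, and both numerators in
`le_phaseProb` equal `sin²(πδ)`. For `δ = 0` the grid point is hit with certainty. -/
theorem le_phaseProb_add_phaseProb (M : ℕ) (hM : 2 ≤ M) {δ : ℝ} (h0 : 0 ≤ δ) (h1 : δ < 1) :
    8 / Real.pi ^ 2 ≤
      phaseProb M (Real.pi * δ / M) + phaseProb M (Real.pi * (δ - 1) / M) := by
  have hM' : (2 : ℝ) ≤ M := by exact_mod_cast hM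
  have hpi := Real.pi_pos
  rcases h0.eq_or_lt with rfl | hpos
  · rw [mul_zero, zero_div, phaseProb_zero M (by omega)]
    have : 8 / Real.pi ^ 2 ≤ 1 := by
      rw [div_le_one (by positivity)]
      nlinarith [Real.pi_gt_three]
    linarith [phaseProb_nonneg M (Real.pi * (0 - 1) / M)]
  have hd : 0 < 1 - δ := by linarith
  have a0 : Real.pi * δ / M ≠ 0 := by positivity
  have b0 : |Real.pi * δ / M| < Real.pi := by
    rw [abs_of_nonneg (by positivity), div_lt_iff₀ (by linarith)]
    nlinarith
  have hneg : Real.pi * (δ - 1) / M = -(Real.pi * (1 - δ) / M) := by ring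
  have a1 : Real.pi * (δ - 1) / M ≠ 0 := by
    rw [hneg, neg_ne_zero]; positivity
  have b1 : |Real.pi * (δ - 1) / M| < Real.pi := by
    rw [hneg, abs_neg, abs_of_nonneg (by positivity), div_lt_iff₀ (by linarith)]
    nlinarith
  refine le_trans ?_ (add_le_add (le_phaseProb M (by omega) a0 b0) (le_phaseProb M (by omega) a1 b1))
  rw [mul_div_cancel₀ _ (by positivity : (M : ℝ) ≠ 0),
    mul_div_cancel₀ _ (by positivity : (M : ℝ) ≠ 0),
    show Real.pi * (δ - 1) = Real.pi * δ - Real.pi by ring, Real.sin_sub_pi, neg_sq]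
  have key := eight_mul_le_sin_sq h0 h1.le
  have e : Real.sin (Real.pi * δ) ^ 2 / (Real.pi * δ) ^ 2 +
      Real.sin (Real.pi * δ) ^ 2 / (Real.pi * δ - Real.pi) ^ 2 =
      Real.sin (Real.pi * δ) ^ 2 * (δ ^ 2 + (1 - δ) ^ 2) / (δ ^ 2 * (1 - δ) ^ 2) /
        Real.pi ^ 2 := by
    rw [show (Real.pi * δ - Real.pi) ^ 2 = (Real.pi * (1 - δ)) ^ 2 by ring]
    field_simp
    ring
  rw [e]
  refine div_le_div_of_nonneg_right ?_ (by positivity)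
  rwa [le_div_iff₀ (by positivity)]

theorem abs_sin_sq_sub_sin_sq_le {β φ ε : ℝ} (h : |β - φ| ≤ ε) :
    |Real.sin β ^ 2 - Real.sin φ ^ 2| ≤ 2 * ε * |Real.sin φ| + ε ^ 2 := by
  have h1 : |Real.sin β - Real.sin φ| ≤ ε := (Real.abs_sin_sub_sin_le β φ).trans h
  have hε : 0 ≤ ε := (abs_nonneg _).trans h
  have h2 : |Real.sin β + Real.sin φ| ≤ ε + 2 * |Real.sin φ| := by
    calc |Real.sin β + Real.sin φ| = |(Real.sin β - Real.sin φ) + 2 * Real.sin φ| := by ring_nf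
      _ ≤ |Real.sin β - Real.sin φ| + |2 * Real.sin φ| := abs_add_le _ _
      _ ≤ _ := by rw [abs_mul, abs_two]; linarith
  rw [show Real.sin β ^ 2 - Real.sin φ ^ 2 =
    (Real.sin β - Real.sin φ) * (Real.sin β + Real.sin φ) by ring, abs_mul]
  calc _ ≤ ε * (ε + 2 * |Real.sin φ|) := mul_le_mul h1 h2 (abs_nonneg _) hε
    _ = _ := by ring

/-- With probability at least `8/π²`, phase estimation of `φ/π` in `ℤ/M` finds one of the two
neighbours of `Mφ/π`. -/
theorem le_sum_phaseProb (M : ℕ) (hM : 2 ≤ M) (φ : ℝ) (S : Finset (Fin M))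
    (hS : ∀ y : Fin M, |Real.sin (Real.pi * y / M) ^ 2 - Real.sin φ ^ 2| ≤
      2 * (Real.pi / M) * |Real.sin φ| + (Real.pi / M) ^ 2 → y ∈ S) :
    8 / Real.pi ^ 2 ≤ ∑ y ∈ S, phaseProb M (φ - Real.pi * y / M) := by
  have hM' : (0 : ℝ) < M := by exact_mod_cast (by omega : 0 < M)
  have hpi := Real.pi_pos
  -- The neighbours of `Mφ/π` may lie outside `[0, M)`. Reducing them mod `M` shifts the angle by a
  -- multiple of `π`, which changes neither `sin²` nor `phaseProb`.
  have hrep : ∀ z : ℤ, ∃ (y : Fin M) (q : ℤ), ((y : ℕ) : ℤ) = z - M * q := by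
    intro z
    have hMz : (0 : ℤ) < M := by omega
    have hn := Int.emod_nonneg z hMz.ne'
    have hl := Int.emod_lt_of_pos z hMz
    refine ⟨⟨(z % M).toNat, by omega⟩, z / M, ?_⟩
    have := Int.emod_add_mul_ediv z M
    simp only
    omega
  have hreal : ∀ (y : Fin M) (z q : ℤ), ((y : ℕ) : ℤ) = z - M * q →
      Real.pi * y / M = Real.pi * z / M - q * Real.pi := by
    intro y z q h
    have : ((y : ℕ) : ℝ) = z - M * q := by exact_mod_cast h
    rw [this]
    field_simp
  set x := M * φ / Real.pi with hx
  have hφ : φ = Real.pi * x / M := by rw [hx]; field_simp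
  have hmem : ∀ (y : Fin M) (z q : ℤ), ((y : ℕ) : ℤ) = z - M * q → |(z : ℝ) - x| ≤ 1 → y ∈ S := by
    intro y z q h hz
    apply hS
    have hsq : Real.sin (Real.pi * y / M) ^ 2 = Real.sin (Real.pi * z / M) ^ 2 := by
      rw [hreal y z q h, Real.sin_sq_eq_half_sub, Real.sin_sq_eq_half_sub,
        show 2 * (Real.pi * z / M - q * Real.pi) = 2 * (Real.pi * z / M) - q * (2 * Real.pi) by ring,
        Real.cos_sub_int_mul_two_pi]
    rw [hsq]
    apply abs_sin_sq_sub_sin_sq_le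
    rw [hφ, show Real.pi * z / M - Real.pi * x / M = Real.pi / M * (z - x) by ring, abs_mul,
      abs_of_nonneg (by positivity)]
    exact mul_le_of_le_one_right (by positivity) hz
  obtain ⟨y₀, q₀, h₀⟩ := hrep ⌊x⌋
  obtain ⟨y₁, q₁, h₁⟩ := hrep (⌊x⌋ + 1)
  have hf0 := Int.floor_le x
  have hf1 := Int.lt_floor_add_one x
  -- Consecutive integers differ mod `M` because `M ≥ 2`; otherwise one outcome would be counted
  -- twice.
  have hne : y₀ ≠ y₁ := by
    intro h
    rw [h, h₁] at h₀
    have : (M : ℤ) * (q₁ - q₀) = 1 := by linarith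
    have := Int.eq_one_or_neg_one_of_mul_eq_one this
    omega
  have hm0 : y₀ ∈ S := hmem y₀ _ q₀ h₀ (by rw [abs_le]; constructor <;> linarith)
  have hm1 : y₁ ∈ S := hmem y₁ _ q₁ h₁ (by push_cast; rw [abs_le]; constructor <;> linarith)
  have hval : ∀ (y : Fin M) (z q : ℤ), ((y : ℕ) : ℤ) = z - M * q →
      phaseProb M (φ - Real.pi * y / M) = phaseProb M (Real.pi * (x - z) / M) := by
    intro y z q h
    rw [hreal y z q h, ← phaseProb_add_int_mul_pi M (Real.pi * (x - z) / M) q]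
    congr 1
    rw [hφ]
    ring
  have h2 := le_phaseProb_add_phaseProb M hM (δ := x - ⌊x⌋) (by linarith) (by linarith)
  rw [show x - (⌊x⌋ : ℝ) - 1 = x - ((⌊x⌋ + 1 : ℤ) : ℝ) by push_cast; ring, ← hval y₀ _ q₀ h₀,
    ← hval y₁ _ q₁ h₁] at h2
  refine h2.trans ?_
  rw [← Finset.sum_pair (f := fun y : Fin M => phaseProb M (φ - Real.pi * y / M)) hne]
  refine Finset.sum_le_sum_of_subset_of_nonneg ?_ fun _ _ _ => phaseProb_nonneg _ _
  intro y hy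
  rcases Finset.mem_insert.mp hy with rfl | hy
  · exact hm0
  · rw [Finset.mem_singleton.mp hy]; exact hm1

end PhaseEstimation

end DistGrover

namespace DistGrover

/-! ### Outcome probabilities of Grover search and of counting -/

section Probabilities

variable {m : ℕ}

theorem sum_norm_sq_groverState (g : BitString m → Bool) (hg : 1 ≤ solutionCount g) {ι : Type}
    (s : Finset ι) (t : ι → ℕ) (c : ι → ℂ) :
    ∑ x, ‖∑ j ∈ s, c j * groverState g (t j) x‖ ^ 2 =
      ‖∑ j ∈ s, c j * (Real.sin ((2 * t j + 1) * groverAngle g) : ℂ)‖ ^ 2 +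
      ‖∑ j ∈ s, c j * (Real.cos ((2 * t j + 1) * groverAngle g) : ℂ)‖ ^ 2 := by
  have ha : (0 : ℝ) < solutionCount g := by exact_mod_cast hg
  have hb : (0 : ℝ) ≤ 2 ^ m - solutionCount g := sub_nonneg.mpr (solutionCount_le_real g)
  have hdiv : ∀ (r : ℝ) (d : ι → ℝ), 0 ≤ r →
      ‖∑ j ∈ s, c j * ((d j / Real.sqrt r : ℝ) : ℂ)‖ ^ 2 =
        ‖∑ j ∈ s, c j * (d j : ℂ)‖ ^ 2 / r := by
    intro r d hr
    have : ∑ j ∈ s, c j * ((d j / Real.sqrt r : ℝ) : ℂ) =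
        (∑ j ∈ s, c j * (d j : ℂ)) / (Real.sqrt r : ℂ) := by
      rw [Finset.sum_div]
      refine Finset.sum_congr rfl fun j _ => ?_
      push_cast
      ring
    rw [this, norm_div, div_pow, Complex.norm_real, Real.norm_eq_abs, sq_abs, Real.sq_sqrt hr]
  have h1 : ∀ x, ‖∑ j ∈ s, c j * groverState g (t j) x‖ ^ 2 = if g x then
      ‖∑ j ∈ s, c j * (Real.sin ((2 * t j + 1) * groverAngle g) : ℂ)‖ ^ 2 / solutionCount g else
      ‖∑ j ∈ s, c j * (Real.cos ((2 * t j + 1) * groverAngle g) : ℂ)‖ ^ 2 /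
        (2 ^ m - solutionCount g) := by
    intro x
    by_cases h : g x
    · simp only [groverState, h, if_true]
      exact hdiv _ _ ha.le
    · have h' : g x = false := by simpa using h
      simp only [groverState, h', Bool.false_eq_true, if_false]
      exact hdiv _ _ hb
  simp only [h1]
  rw [sum_ite_solution]
  rw [mul_div_cancel₀ _ ha.ne']
  congr 1
  -- Without non-solutions `θ = π/2`, and the cosines of its odd multiples vanish, in agreement with
  -- the empty sum.
  rcases hb.eq_or_lt with h | h
  · have hc : ∀ n : ℕ, Real.cos ((2 * n + 1) * groverAngle g) = 0 := by
      intro n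
      have hN : (solutionCount g : ℝ) = 2 ^ m := by linarith
      have : groverAngle g = Real.pi / 2 := by
        rw [groverAngle, hN, div_self (by positivity), Real.arcsin_one]
      rw [this, Real.cos_eq_zero_iff]
      exact ⟨n, by push_cast; ring⟩
    simp only [hc]
    simp
  · rw [mul_div_cancel₀ _ h.ne']

theorem sum_norm_sq_groverState_solutions (g : BitString m → Bool) (hg : 1 ≤ solutionCount g)
    (t : ℕ) : ∑ x, (if g x then groverState g t x ^ 2 else 0) =
      Real.sin ((2 * t + 1) * groverAngle g) ^ 2 := by
  have ha : (0 : ℝ) < solutionCount g := by exact_mod_cast hg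
  have h1 : ∀ x, (if g x then groverState g t x ^ 2 else 0) =
      if g x then Real.sin ((2 * t + 1) * groverAngle g) ^ 2 / solutionCount g else 0 := by
    intro x
    by_cases h : g x
    · simp only [groverState, h, if_true]
      rw [div_pow, Real.sq_sqrt ha.le]
    · simp [h]
  simp only [h1]
  rw [sum_ite_solution]
  simp only [mul_zero, add_zero]
  rw [mul_div_cancel₀ _ ha.ne']

theorem groverIterations_eq (m b : ℕ) :
    groverIterations m b = ⌊Real.pi * Real.sqrt (2 ^ m) / (4 * Real.sqrt b)⌋₊ := by
  rw [groverIterations, Real.sqrt_div (by positivity), div_mul_div_comm]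

theorem groverOutcome_toOuterMeasure (g : BitString m → Bool) (hg : 1 ≤ solutionCount g) :
    (groverOutcome g (solutionCount g)).toOuterMeasure {x | g x = true} =
      ENNReal.ofReal (groverProb m (solutionCount g)) := by
  have h := sum_norm_sq_groverState_solutions g hg (groverIterations m (solutionCount g))
  rw [groverProb, ← groverIterations_eq]
  rw [groverAngle] at h
  rw [← h, groverOutcome, PMF.toOuterMeasure_map_apply, PMF.toOuterMeasure_apply_fintype,
    Fintype.sum_prod_type, ENNReal.ofReal_sum_of_nonneg]
  · simp only [Finset.univ_unique, Finset.sum_singleton]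
    refine Finset.sum_congr rfl fun x _ => ?_
    by_cases hx : g x
    · rw [Set.indicator_of_mem (by simpa using hx)]
      simp only [measure, PMF.ofFintype_apply, hx, if_true]
      rw [show (default : Unit) = () from rfl, groverCircuit_apply g hg, Complex.norm_real,
        Real.norm_eq_abs, sq_abs]
    · rw [Set.indicator_of_notMem (by simpa using hx)]
      simp [hx]
  · intro x _
    split_ifs <;> positivity

/-- Summing out the second register leaves `|S|² + |C|²` for a sine sum `S` and a cosine sum `C`. By
the parallelogram law this is half of `|C + iS|² + |C - iS|²`, and `C ± iS` are geometric sums with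
phases `±θ`. -/
theorem countOutcome_sum (g : BitString m → Bool) (hg : 1 ≤ solutionCount g) (M : ℕ) [NeZero M]
    (y : Fin M) :
    ∑ x, ‖((countCircuit m M).eval g).1 (y, x) (0, zeroString m)‖ ^ 2 =
      (phaseProb M (groverAngle g - Real.pi * y / M) +
        phaseProb M (-groverAngle g - Real.pi * y / M)) / 2 := by
  set θ := groverAngle g with hθ
  set c : Fin M → ℂ := fun j => Complex.exp (-(2 * Real.pi * Complex.I * j * y / M)) with hc
  set S := ∑ j : Fin M, c j * (Real.sin ((2 * (j : ℕ) + 1) * θ) : ℂ) with hS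
  set C := ∑ j : Fin M, c j * (Real.cos ((2 * (j : ℕ) + 1) * θ) : ℂ) with hC
  have hE : ∀ φ : ℝ, ‖∑ j : Fin M, c j * (Complex.exp (φ * Complex.I) *
      Complex.exp (2 * φ * Complex.I) ^ (j : ℕ))‖ ^ 2 / M ^ 2 =
        phaseProb M (φ - Real.pi * y / M) := by
    intro φ
    set u := Complex.exp (φ * Complex.I) with hu
    rw [phaseProb, ← Fin.sum_univ_eq_sum_range
      (fun j => Complex.exp (2 * ((φ - Real.pi * y / M : ℝ) : ℂ) * Complex.I) ^ j)]
    have : ∀ j : Fin M, c j * (u * Complex.exp (2 * φ * Complex.I) ^ (j : ℕ)) =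
        u * Complex.exp (2 * ((φ - Real.pi * y / M : ℝ) : ℂ) * Complex.I) ^ (j : ℕ) := by
      intro j
      rw [← Complex.exp_nat_mul, ← Complex.exp_nat_mul, hc, mul_left_comm, ← Complex.exp_add]
      congr 2
      push_cast
      ring
    simp only [this]
    rw [← Finset.mul_sum, norm_mul, hu, Complex.norm_exp_ofReal_mul_I, one_mul]
  have hsum : ∀ (φ : ℝ) (σ : ℂ), (∀ r : ℝ, (Real.cos (r * θ) : ℂ) + σ * (Real.sin (r * θ) : ℂ) =
      Complex.exp ((r * φ : ℝ) * Complex.I)) →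
      ‖C + σ * S‖ ^ 2 / M ^ 2 = phaseProb M (φ - Real.pi * y / M) := by
    intro φ σ h
    rw [← hE φ, hC, hS, Finset.mul_sum, ← Finset.sum_add_distrib]
    congr 3
    refine Finset.sum_congr rfl fun j _ => ?_
    have e : Complex.exp (φ * Complex.I) * Complex.exp (2 * φ * Complex.I) ^ (j : ℕ) =
        Complex.exp ((((2 * (j : ℕ) + 1) * φ : ℝ) : ℂ) * Complex.I) := by
      rw [← Complex.exp_nat_mul, ← Complex.exp_add]
      congr 1
      push_cast
      ring
    rw [mul_left_comm, ← mul_add, h, e]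
  have hp := hsum θ Complex.I fun r => by
    rw [Complex.exp_mul_I, ← Complex.ofReal_cos, ← Complex.ofReal_sin]; ring
  have hm := hsum (-θ) (-Complex.I) fun r => by
    rw [mul_neg, Complex.exp_mul_I, ← Complex.ofReal_cos, ← Complex.ofReal_sin, Real.cos_neg,
      Real.sin_neg]
    push_cast
    ring
  rw [← hp, ← hm]
  have h := sum_norm_sq_groverState g hg Finset.univ (fun j : Fin M => (j : ℕ)) c
  rw [← hθ, ← hS, ← hC] at h
  have hpar := parallelogram_law_with_norm ℝ C (Complex.I * S)
  rw [norm_mul, Complex.norm_I, one_mul] at hpar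
  have h1 : ∀ x, ‖((countCircuit m M).eval g).1 (y, x) (0, zeroString m)‖ ^ 2 =
      ‖∑ j : Fin M, c j * groverState g j x‖ ^ 2 / M ^ 2 := by
    intro x
    rw [countCircuit_apply g hg, norm_mul, mul_pow, norm_div, norm_one, Complex.norm_natCast,
      div_pow, one_pow, one_div, div_eq_inv_mul]
  simp only [h1]
  rw [← Finset.sum_div, h, neg_mul, ← sub_eq_add_neg]
  rw [← add_div, hpar]
  ring

theorem two_le_countParam (hm : 1 ≤ m) : 2 ≤ countParam m := by
  rw [countParam, Nat.succ_le_iff, Nat.lt_ceil, Nat.cast_one]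
  refine Real.lt_sqrt_of_sq_lt ?_
  rw [one_pow]
  exact one_lt_pow₀ one_lt_two (by omega)

theorem abs_sub_countEstimate_le (a' : ℕ) (g : BitString m → Bool) (ha : solutionCount g ≤ a')
    (y : Fin (countParam m))
    (h : |Real.sin (Real.pi * y / countParam m) ^ 2 - Real.sin (groverAngle g) ^ 2| ≤
      2 * (Real.pi / countParam m) * |Real.sin (groverAngle g)| + (Real.pi / countParam m) ^ 2) :
    |(solutionCount g : ℤ) - countEstimate m y| ≤ countError a' := by
  set N : ℝ := 2 ^ m with hN
  have hN0 : 0 < N := by positivity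
  have hM0 : (0 : ℝ) < countParam m := by exact_mod_cast Nat.pos_of_ne_zero (NeZero.ne _)
  have hM : Real.sqrt N ≤ countParam m := Nat.le_ceil _
  set M : ℝ := ((countParam m : ℕ) : ℝ)
  have hpi := Real.pi_pos
  have hs : Real.sqrt N / M ≤ 1 := (div_le_one hM0).mpr hM
  have hs0 : 0 ≤ Real.sqrt N / M := by positivity
  set v := N * Real.sin (Real.pi * y / M) ^ 2 with hv
  have hsq := Real.sq_sqrt hN0.le
  have hsin : N * Real.sin (groverAngle g) ^ 2 = solutionCount g := by
    rw [sin_groverAngle, div_pow, Real.sq_sqrt (by positivity), Real.sq_sqrt hN0.le]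
    field_simp
  have hab : |(solutionCount g : ℝ) - v| ≤ 2 * Real.pi * Real.sqrt (solutionCount g) +
      Real.pi ^ 2 := by
    have e0 : v - solutionCount g =
        N * (Real.sin (Real.pi * y / M) ^ 2 - Real.sin (groverAngle g) ^ 2) := by
      rw [mul_sub, hsin]
    rw [abs_sub_comm, e0, abs_mul, abs_of_pos hN0]
    refine (mul_le_mul_of_nonneg_left h hN0.le).trans ?_
    rw [sin_groverAngle, abs_of_nonneg (by positivity)]
    have e1 : N * (2 * (Real.pi / M) * (Real.sqrt (solutionCount g) / Real.sqrt N) +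
        (Real.pi / M) ^ 2) = 2 * Real.pi * Real.sqrt (solutionCount g) * (Real.sqrt N / M) +
        Real.pi ^ 2 * (Real.sqrt N / M) ^ 2 := by
      field_simp
      rw [hsq]
    rw [e1]
    refine add_le_add (mul_le_of_le_one_right (by positivity) hs)
      (mul_le_of_le_one_right (by positivity) (pow_le_one₀ hs0 hs))
  have hr := abs_sub_round v
  -- With the rounding error `1/2` this stays below the constant `11` in `t_a`.
  have hpi2 : Real.pi ^ 2 ≤ 10 := by nlinarith [Real.pi_lt_d2]
  have hmono : Real.sqrt (solutionCount g) ≤ Real.sqrt a' :=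
    Real.sqrt_le_sqrt (by exact_mod_cast ha)
  have htri : |(solutionCount g : ℝ) - round v| ≤ |(solutionCount g : ℝ) - v| + |v - round v| :=
    abs_sub_le _ _ _
  have hfin : |(solutionCount g : ℝ) - round v| ≤ countError a' := by
    refine le_trans ?_ (Nat.le_ceil _)
    have := mul_le_mul_of_nonneg_left hmono (by positivity : 0 ≤ 2 * Real.pi)
    linarith
  have : countEstimate m y = round v := rfl
  rw [this]
  exact_mod_cast hfin

/-- The accuracy condition depends on the phase only through `sin²` and `|sin|`, so one set of good
outcomes serves both `θ` and `-θ`, and the average keeps the bound. -/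
theorem countOutcome_toOuterMeasure (hm : 1 ≤ m) (g : BitString m → Bool)
    (hg : 1 ≤ solutionCount g) (a' : ℕ) (ha : solutionCount g ≤ a') :
    ENNReal.ofReal (8 / Real.pi ^ 2) ≤ (countOutcome g (countParam m)).toOuterMeasure
      {y | |(solutionCount g : ℤ) - countEstimate m y| ≤ countError a'} := by
  classical
  set S : Finset (Fin (countParam m)) :=
    Finset.univ.filter fun y => |(solutionCount g : ℤ) - countEstimate m y| ≤ countError a' with hS
  have h1 := le_sum_phaseProb _ (two_le_countParam hm) (groverAngle g) S fun y hy => by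
    rw [hS, Finset.mem_filter]
    exact ⟨Finset.mem_univ y, abs_sub_countEstimate_le a' g ha y hy⟩
  have h2 := le_sum_phaseProb _ (two_le_countParam hm) (-groverAngle g) S fun y hy => by
    rw [Real.sin_neg, neg_sq, abs_neg] at hy
    rw [hS, Finset.mem_filter]
    exact ⟨Finset.mem_univ y, abs_sub_countEstimate_le a' g ha y hy⟩
  have h3 : 8 / Real.pi ^ 2 ≤ ∑ y ∈ S, ∑ x,
      ‖((countCircuit m (countParam m)).eval g).1 (y, x) (0, zeroString m)‖ ^ 2 := by
    simp only [countOutcome_sum g hg]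
    rw [← Finset.sum_div, Finset.sum_add_distrib]
    linarith
  refine (ENNReal.ofReal_le_ofReal h3).trans (le_of_eq ?_)
  rw [countOutcome, PMF.toOuterMeasure_map_apply, PMF.toOuterMeasure_apply_fintype,
    Fintype.sum_prod_type, hS, Finset.sum_filter, ENNReal.ofReal_sum_of_nonneg]
  · refine Finset.sum_congr rfl fun y _ => ?_
    split_ifs with h
    · rw [ENNReal.ofReal_sum_of_nonneg fun _ _ => by positivity]
      refine Finset.sum_congr rfl fun x _ => ?_
      rw [Set.indicator_of_mem (by simpa using h)]
      rfl
    · rw [ENNReal.ofReal_zero]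
      symm
      refine Finset.sum_eq_zero fun x _ => ?_
      rw [Set.indicator_of_notMem (by simpa using h)]
  · intro y _
    split_ifs
    · exact Finset.sum_nonneg fun _ _ => by positivity
    · exact le_rfl

end Probabilities

end DistGrover

namespace DistGrover

/-! ### Guarantees for a single machine and its marginal law -/

section Machine

theorem groverSearch_support {m : ℕ} (g : BitString m → Bool) (bs : List ℕ)
    (r : Option (BitString m) × ℕ) (hr : r ∈ (groverSearch g bs).support) :
    (∀ x, r.1 = some x → g x = true) ∧
      r.2 ≤ (bs.map fun b : ℕ => ⌊Real.pi / 4 * Real.sqrt (2 ^ m / b)⌋₊).sum + bs.length := by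
  induction bs generalizing r with
  | nil =>
    rw [groverSearch, PMF.mem_support_pure_iff] at hr
    subst hr
    simp
  | cons b bs ih =>
    rw [groverSearch, PMF.mem_support_bind_iff] at hr
    obtain ⟨x, -, hx⟩ := hr
    simp only [groverCircuit_cost, groverIterations] at hx
    simp only [List.map_cons, List.sum_cons, List.length_cons]
    split_ifs at hx with h
    · rw [PMF.mem_support_pure_iff] at hx
      subst hx
      refine ⟨fun z hz => ?_, by simp only; omega⟩
      rw [← Option.some.inj hz]
      exact h
    · rw [PMF.mem_support_map_iff] at hx
      obtain ⟨r', hr', rfl⟩ := hx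
      obtain ⟨h1, h2⟩ := ih r' hr'
      exact ⟨h1, by simp only; omega⟩

/-- An earlier candidate either succeeds, which gives conditional success probability one, or passes
the search on to the tail, where induction applies. -/
theorem le_groverSearch_toOuterMeasure {m : ℕ} (g : BitString m → Bool) (bs : List ℕ) (b : ℕ)
    (hb : b ∈ bs) : (groverOutcome g b).toOuterMeasure {x | g x = true} ≤
      (groverSearch g bs).toOuterMeasure {r | r.1.isSome} := by
  induction bs with
  | nil => simp at hb
  | cons c bs ih =>
    rw [groverSearch, PMF.toOuterMeasure_bind_apply]
    rcases List.mem_cons.mp hb with rfl | hb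
    · rw [PMF.toOuterMeasure_apply]
      refine ENNReal.tsum_le_tsum fun x => ?_
      by_cases h : g x = true
      · rw [Set.indicator_of_mem (by simpa using h)]
        simp [h, PMF.toOuterMeasure_pure_apply]
      · rw [Set.indicator_of_notMem (by simpa using h)]
        exact zero_le
    · have hone := (groverOutcome g c).tsum_coe
      calc (groverOutcome g b).toOuterMeasure {x | g x = true}
          = ∑' x, groverOutcome g c x * (groverOutcome g b).toOuterMeasure {x | g x = true} := by
            rw [ENNReal.tsum_mul_right, hone, one_mul]
        _ ≤ _ := by
          refine ENNReal.tsum_le_tsum fun x => mul_le_mul_right ?_ _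
          by_cases h : g x = true
          · simp only [h, if_true]
            rw [PMF.toOuterMeasure_pure_apply, if_pos (by simp)]
            refine ((groverOutcome g b).toOuterMeasure.mono (Set.subset_univ _)).trans ?_
            exact (((groverOutcome g b).toOuterMeasure_apply_eq_one_iff _).mpr
              (Set.subset_univ _)).le
          · simp only [h]
            rw [if_neg (by simp), PMF.toOuterMeasure_map_apply]
            exact ih hb

theorem card_possibleCounts_le (a : ℕ) (c : ℤ) :
    (possibleCounts a c).card ≤ 2 * countError a + 1 := by
  have h : ((possibleCounts a c).map Nat.castEmbedding : Finset ℤ) ⊆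
      Finset.Icc (c - countError a) (c + countError a) := by
    intro z hz
    obtain ⟨b, hb, rfl⟩ := Finset.mem_map.mp hz
    have := abs_le.mp (Finset.mem_filter.mp hb).2
    rw [Finset.mem_Icc, Nat.castEmbedding_apply]
    omega
  have := Finset.card_le_card h
  rw [Finset.card_map, Int.card_Icc] at this
  omega

variable {n k : ℕ}

theorem appendIndex_injective (i : Fin (2 ^ k)) :
    Function.Injective fun x : BitString (n - k) => (appendIndex x i : BitString n) := by
  intro x x' h
  funext j
  have := congrFun h ⟨j, by omega⟩
  simpa [appendIndex] using this

/-- Ensures that the cap `b ≤ a` on the candidates does not exclude `a_i`. -/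
theorem solutionCount_subfunction_le (f : BitString n → Bool) (i : Fin (2 ^ k)) :
    solutionCount (subfunction f i) ≤ solutionCount f := by
  refine Finset.card_le_card_of_injOn (fun x => appendIndex x i) ?_
    (appendIndex_injective i).injOn
  intro x hx
  exact Finset.mem_coe.mpr (Finset.mem_filter.mpr
    ⟨Finset.mem_univ _, (Finset.mem_filter.mp (Finset.mem_coe.mp hx)).2⟩)

/-- Counting costs `M - 1` queries, and the checks cost at most one per candidate, hence at most `2
t_a + 1`; the query bound holds with one to spare. -/
theorem machine_support (f : BitString n → Bool) (a : ℕ) (i : Fin (2 ^ k))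
    (hi : 1 ≤ solutionCount (subfunction f i)) (B : Fin (countParam (n - k)) → List ℕ)
    (hB : ∀ y, (B y).Nodup ∧ (B y).toFinset = possibleCounts a (countEstimate (n - k) y))
    (r : Run n) (hr : r ∈ (machine f i B).support) :
    r.candidates.length ≤ 2 * countError a + 1 ∧ (∀ b ∈ r.candidates, 1 ≤ b ∧ b ≤ a) ∧
      r.queries ≤ queryBound (n - k) a r.candidates ∧ ∀ z, r.output = some z → f z = true := by
  rw [machine, PMF.mem_support_bind_iff] at hr
  obtain ⟨y, -, hy⟩ := hr
  simp only [show ¬ solutionCount (subfunction f i) = 0 by omega, if_false] at hy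
  rw [PMF.mem_support_map_iff] at hy
  obtain ⟨s, hs, rfl⟩ := hy
  obtain ⟨h1, h2⟩ := groverSearch_support _ _ _ hs
  have hlen : (B y).length ≤ 2 * countError a + 1 := by
    rw [← List.toFinset_card_of_nodup (hB y).1, (hB y).2]
    exact card_possibleCounts_le _ _
  refine ⟨hlen, fun b hb => ?_, ?_, fun z hz => ?_⟩
  · have : b ∈ (B y).toFinset := List.mem_toFinset.mpr hb
    rw [(hB y).2] at this
    exact Finset.mem_Icc.mp (Finset.mem_filter.mp this).1
  · simp only [queryBound, countCircuit_cost]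
    have : countParam (n - k) = ⌈Real.sqrt (2 ^ (n - k))⌉₊ := rfl
    rw [this]
    omega
  · obtain ⟨x, hx, rfl⟩ := Option.map_eq_some_iff.mp hz
    exact h1 x hx

/-- For every good `y` the list contains `a_i`, so the conditional success probability is at least
`P_G`, whatever the order of the list; the other `y` are bounded below by zero. -/
theorem le_machine_toOuterMeasure (hkn : k < n) (f : BitString n → Bool) (i : Fin (2 ^ k))
    (hi : 1 ≤ solutionCount (subfunction f i)) (B : Fin (countParam (n - k)) → List ℕ)
    (hB : ∀ y, (B y).toFinset =
      possibleCounts (solutionCount f) (countEstimate (n - k) y)) :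
    ENNReal.ofReal (8 / Real.pi ^ 2 * groverProb (n - k) (solutionCount (subfunction f i))) ≤
      (machine f i B).toOuterMeasure {r | r.output.isSome} := by
  set g := subfunction f i with hg
  have hle := solutionCount_subfunction_le f i
  have hcount := countOutcome_toOuterMeasure (by omega) g hi (solutionCount f) hle
  rw [ENNReal.ofReal_mul (by positivity), machine, PMF.toOuterMeasure_bind_apply]
  refine (mul_le_mul_left hcount _).trans ?_
  rw [PMF.toOuterMeasure_apply, ← ENNReal.tsum_mul_right]
  refine ENNReal.tsum_le_tsum fun y => ?_
  by_cases h : |(solutionCount g : ℤ) - countEstimate (n - k) y| ≤ countError (solutionCount f)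
  · rw [Set.indicator_of_mem (by simpa using h)]
    refine mul_le_mul_right ?_ _
    rw [← hg]
    simp only [show ¬ solutionCount g = 0 by omega, if_false]
    rw [PMF.toOuterMeasure_map_apply, ← groverOutcome_toOuterMeasure g hi]
    refine (le_groverSearch_toOuterMeasure g (B y) (solutionCount g) ?_).trans (le_of_eq ?_)
    · rw [← List.mem_toFinset, hB]
      exact Finset.mem_filter.mpr ⟨Finset.mem_Icc.mpr ⟨hi, hle⟩, h⟩
    · congr 1
      ext r
      simp
  · rw [Set.indicator_of_notMem (by simpa using h), zero_mul]
    exact zero_le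

theorem parallelRun_preimage (f : BitString n → Bool)
    (B : Fin (2 ^ k) → Fin (countParam (n - k)) → List ℕ) (i : Fin (2 ^ k)) (S : Set (Run n)) :
    parallelRun f B {ω | ω i ∈ S} = (machine f i (B i)).toOuterMeasure S := by
  have h := (measurePreserving_eval (fun i => (machine f i (B i)).toMeasure) i).measure_preimage
    (s := S) (MeasurableSet.nullMeasurableSet trivial)
  rw [PMF.toMeasure_apply_eq_toOuterMeasure_apply _ (by trivial)] at h
  exact h

end Machine

end DistGrover

theorem mainTheorem2 (n k : ℕ) (hk : 1 ≤ k) (hkn : k < n)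
    (f : BitString n → Bool) (a : ℕ) (ha : a = solutionCount f) (ha1 : 1 ≤ a)
    (B : Fin (2 ^ k) → Fin (countParam (n - k)) → List ℕ)
    (hB : ∀ i y, (B i y).Nodup ∧
      (B i y).toFinset = possibleCounts a (countEstimate (n - k) y))
    (i : Fin (2 ^ k)) (ai : ℕ) (hai : ai = solutionCount (subfunction f i)) (hai1 : 1 ≤ ai) :
    (groverOutcome (subfunction f i) ai).toOuterMeasure {x | subfunction f i x = true}
        = ENNReal.ofReal (groverProb (n - k) ai) ∧
    (∀ᵐ ω ∂(parallelRun f B),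
      (ω i).candidates.length ≤ 2 * countError a + 1 ∧
      (∀ b ∈ (ω i).candidates, 1 ≤ b ∧ b ≤ a) ∧
      (ω i).queries ≤ queryBound (n - k) a (ω i).candidates ∧
      (∀ z, (ω i).output = some z → f z = true)) ∧
    ENNReal.ofReal (8 / Real.pi ^ 2 * groverProb (n - k) ai) ≤
      parallelRun f B {ω | ∃ z, (ω i).output = some z ∧ f z = true ∧
        (ω i).queries ≤ queryBound (n - k) a (ω i).candidates} := by
  subst ha hai
  have hsupp := machine_support f (solutionCount f) i hai1 (B i) (hB i)
  refine ⟨groverOutcome_toOuterMeasure _ hai1, ?_, ?_⟩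
  · have hmem : ∀ᵐ ω ∂(parallelRun f B), ω i ∈ (machine f i (B i)).support := by
      rw [ae_iff]
      refine (parallelRun_preimage f B i (machine f i (B i)).supportᶜ).trans ?_
      rw [PMF.toOuterMeasure_apply_eq_zero_iff]
      exact disjoint_compl_right
    filter_upwards [hmem] with ω h using hsupp _ h
  · refine le_trans ?_ (parallelRun_preimage f B i {r | ∃ z, r.output = some z ∧ f z = true ∧
      r.queries ≤ queryBound (n - k) (solutionCount f) r.candidates}).ge
    refine (le_machine_toOuterMeasure hkn f i hai1 (B i) fun y => (hB i y).2).trans ?_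
    -- The inclusion need only be checked on the support, where `machine_support` turns any output
    -- into a correct one within the query bound.
    refine PMF.toOuterMeasure_mono _ ?_
    rintro r ⟨hr, hr'⟩
    obtain ⟨z, hz⟩ := Option.isSome_iff_exists.mp hr
    obtain ⟨-, -, h3, h4⟩ := hsupp r hr'
    exact ⟨z, hz, h4 z hz, h3⟩
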